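/- Throughout, for a uniform space $X$, an entourage $U$ and $x\in X$, write $U[x]=\{y\in X:(x,y)\in U\}$. The \emph{proximal game} on a uniform space $X$ is the following game of length $\omega$. In inning $0$, player 1 chooses a symmetric entourage $U_0$ and player 2 chooses a point $x_0\in X$. In inning $n+1$, player 1 chooses a symmetric entourage $U_{n+1}\subseteq U_n$ and player 2 chooses a point $x_{n+1}\in U_n[x_n]$. Player 1 wins if $\bigcap_{n<\omega}U_n[x_n]=\emptyset$ or the sequence $(x_n)_{n<\omega}$ converges in $X$. A topological space is \emph{proximal} if there is a uniformity inducing its topology for which player 1 has a winning strategy in the proximal game. The \emph{countable uniform power} of a uniform space $X$ is the set ${}^{\omega}X$ of all sequences in $X$ with the topology given by the uniformity of uniform convergence, i.e. the uniformity with base the sets $\{(f,g):(f(n),g(n))\in U \text{ for all } n<\omega\}$, $U$ an entourage of $X$. A compact Hausdorff space carries exactly one uniformity inducing its topology, and its countable uniform power is formed with that uniformity. A compact Hausdorff space is a \emph{Corson compactum} if, for some index set $\kappa$, it is homeomorphic to a subspace of $\{x\in[0,1]^{\kappa}: x(\alpha)\ne 0 \text{ for at most countably many } \alpha\in\kappa\}$.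 Theorem. Let $X$ be a compact Hausdorff space. (1) If $X$ is proximal, then the countable uniform power of $X$ is proximal. (2) If $X$ is a Corson compactum, then the countable uniform power of $X$ is collectionwise normal, countably paracompact and Fréchet–Urysohn. -/

import Mathlib

open scoped Uniformity Topology UniformConvergence

universe u

/-- A strategy of player 1 in the proximal game on the uniform space `X`. A history before inning
`n` consists of the points `x 0, …, x (n - 1)` chosen so far by player 2; the strategy answers it
with a (symmetric) entourage contained in the entourage chosen in the preceding inning. -/
structure ProximalStrategy (X : Type u) [UniformSpace X] where
  /-- The entourage chosen in inning `n`. -/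
  move : (n : ℕ) → (Fin n → X) → Set (X × X)
  entourage : ∀ (n : ℕ) (h : Fin n → X), move n h ∈ 𝓤 X
  symmetric : ∀ (n : ℕ) (h : Fin n → X) (x y : X), (x, y) ∈ move n h → (y, x) ∈ move n h
  decreasing : ∀ (n : ℕ) (h : Fin (n + 1) → X), move (n + 1) h ⊆ move n (fun i => h i.castSucc)

/-- The entourage `U n` chosen by player 1 in inning `n` when player 1 follows `σ` and player 2
chooses the points `x 0, x 1, …`. -/
def ProximalStrategy.play {X : Type u} [UniformSpace X] (σ : ProximalStrategy X) (x : ℕ → X)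
    (n : ℕ) : Set (X × X) :=
  σ.move n (fun i => x i)

/-- `σ` is winning: whenever player 2 obeys the rule `x (n + 1) ∈ U n [x n]`, either
`⋂ n, U n [x n] = ∅` or the sequence `x` converges. -/
def ProximalStrategy.IsWinning {X : Type u} [UniformSpace X] (σ : ProximalStrategy X) : Prop :=
  ∀ x : ℕ → X, (∀ n, x (n + 1) ∈ UniformSpace.ball (x n) (σ.play x n)) →
    (⋂ n, UniformSpace.ball (x n) (σ.play x n)) = ∅ ∨
      ∃ a, Filter.Tendsto x Filter.atTop (𝓝 a)

/-- A topological space is proximal if, for some uniformity inducing its topology, player 1 has a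
winning strategy in the proximal game. -/
def IsProximal (X : Type u) [t : TopologicalSpace X] : Prop :=
  ∃ 𝔘 : UniformSpace X, 𝔘.toTopologicalSpace = t ∧
    ∃ σ : @ProximalStrategy X 𝔘, @ProximalStrategy.IsWinning X 𝔘 σ

/-- `X` embeds into a `Σ`-product of copies of the unit interval: the set of those points of a
power of `[0, 1]` that have countable support. A Corson compactum is a compact space with this
property. -/
def EmbedsInSigmaProduct (X : Type u) [TopologicalSpace X] : Prop :=
  ∃ (κ : Type u) (e : X → κ → unitInterval),
    Topology.IsEmbedding e ∧ ∀ x, {α | e x α ≠ 0}.Countable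

/-- Collectionwise normality: `X` is `T₁`, and every discrete family of closed sets (each point
has a neighbourhood that meets at most one member) can be separated by pairwise disjoint open
sets. -/
def IsCollectionwiseNormal (X : Type u) [TopologicalSpace X] : Prop :=
  T1Space X ∧ ∀ (ι : Type u) (F : ι → Set X), (∀ i, IsClosed (F i)) →
    (∀ x, ∃ W ∈ 𝓝 x, {i | (F i ∩ W).Nonempty}.Subsingleton) →
    ∃ V : ι → Set X, (∀ i, IsOpen (V i)) ∧ (∀ i, F i ⊆ V i) ∧
      Pairwise (fun i j => Disjoint (V i) (V j))

/-- Countable paracompactness: `X` is Hausdorff, and every countable open cover has a locally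
finite open refinement (which may be indexed by the same set as the cover). -/
def IsCountablyParacompact (X : Type u) [TopologicalSpace X] : Prop :=
  T2Space X ∧ ∀ U : ℕ → Set X, (∀ n, IsOpen (U n)) → (⋃ n, U n) = Set.univ →
    ∃ V : ℕ → Set X, (∀ n, IsOpen (V n)) ∧ (⋃ n, V n) = Set.univ ∧ LocallyFinite V ∧
      ∀ n, V n ⊆ U n

/-- The countable uniform power of the uniform space `X`: the set of all sequences in `X` with the
uniformity (and topology) of uniform convergence, a base of which is formed by the sets
`{(f, g) | ∀ n, (f n, g n) ∈ U}`, where `U` is an entourage of `X`. -/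
abbrev UniformPower (X : Type u) : Type u := ℕ →ᵤ X

/-! For (1), shrink a winning strategy `σ` on `X` to `τ` so that three `τ`-steps make one `σ`-step.
If `a`, `b` lie in the closure of `D` and all answers of `τ` to histories from `D` contain `(a, b)`,
then `a = b`: otherwise player 2 alternates between points of `D` near `a` and near `b`, a legal
play with nonempty intersection that diverges. By compactness, closed decreasing sets that
eventually refine all these answers become arbitrarily small on `D` (`exists_inter_prod_subset`). In
the power, player 1 answers in inning `n` at once all histories of length at most `n` formed from
the values `f i k` with `i, k < n`. With `D` the set of all values played, every play is uniformly
Cauchy, and the power is complete.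

For (2), a Corson compactum is proximal: player 1 gradually controls more coordinates from the
supports of the points played. By (1), it remains to see that proximal Hausdorff spaces have the
three properties. The covering properties come from a tree of open sets refined along plays against
`σ`. An infinite branch through a point would give a convergent play, which the choice of the points
played excludes; so the nodes where branches may stop form a `σ`-locally finite cover
(`exists_sigma_locallyFinite_cover`). -/

/-- A sequence determined recursively by its history. -/
def seqOfHistory {α : Type*} (F : (n : ℕ) → (Fin n → α) → α) (n : ℕ) : α :=
  F n fun i => seqOfHistory F i
termination_by n
decreasing_by exact i.2

theorem exists_seq_eq_of_history {α : Type*} (F : (n : ℕ) → (Fin n → α) → α) :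
    ∃ x : ℕ → α, ∀ n, x n = F n fun i => x i :=
  ⟨seqOfHistory F, fun n => by rw [seqOfHistory]⟩

/-! ### Small entourages and locally finite covers. -/

theorem exists_isClosed_symm_comp_comp_subset {X : Type*} [UniformSpace X] {E : Set (X × X)}
    (hE : E ∈ 𝓤 X) :
    ∃ W ∈ 𝓤 X, IsClosed W ∧ (∀ x y, (x, y) ∈ W → (y, x) ∈ W) ∧
      ∀ a b c d, (a, b) ∈ W → (b, c) ∈ W → (c, d) ∈ W → (a, d) ∈ E := by
  obtain ⟨t, ht, -, htE⟩ := comp_comp_symm_mem_uniformity_sets hE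
  obtain ⟨s, ⟨hs, hsc⟩, hst⟩ := uniformity_hasBasis_closed.mem_iff.1 ht
  refine ⟨s ∩ Prod.swap ⁻¹' s, Filter.inter_mem hs (symm_le_uniformity hs),
    hsc.inter (hsc.preimage continuous_swap), fun x y h => ⟨h.2, h.1⟩, fun a b c d h₁ h₂ h₃ => ?_⟩
  exact htE ⟨c, ⟨b, hst h₁.1, hst h₂.1⟩, hst h₃.1⟩

/-- Every entourage belongs to a coarser uniformity that has a countable base. -/
theorem exists_isCountablyGenerated_uniformity_le {X : Type*} [𝔘 : UniformSpace X]
    {E : Set (X × X)} (hE : E ∈ 𝓤 X) :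
    ∃ 𝔙 : UniformSpace X, 𝔘 ≤ 𝔙 ∧ E ∈ 𝓤[𝔙] ∧ (𝓤[𝔙]).IsCountablyGenerated := by
  choose! W hW hc hsymm hcomp using
    fun (E : Set (X × X)) (hE : E ∈ 𝓤 X) => exists_isClosed_symm_comp_comp_subset hE
  let V : ℕ → Set (X × X) := fun n => W^[n] E
  have hVs (n : ℕ) : V (n + 1) = W (V n) := Function.iterate_succ_apply' W n E
  have hV (n : ℕ) : V n ∈ 𝓤 X := by
    induction n with
    | zero => exact hE
    | succ n ih => rw [hVs]; exact hW _ ih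
  have hVV (n : ℕ) : V (n + 1) ⊆ V n := by
    rintro ⟨x, y⟩ h
    rw [hVs] at h
    exact hcomp _ (hV n) x y y y h (refl_mem_uniformity (hW _ (hV n)))
      (refl_mem_uniformity (hW _ (hV n)))
  have hanti : Antitone V := antitone_nat_of_succ_le hVV
  have hbasis : (⨅ n, Filter.principal (V n)).HasBasis (fun _ => True) V :=
    Filter.hasBasis_iInf_principal hanti.directed_ge
  let c : UniformSpace.Core X := UniformSpace.Core.mk' (⨅ n, Filter.principal (V n))
    (fun r hr x => by
      obtain ⟨n, -, hn⟩ := hbasis.mem_iff.1 hr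
      exact hn (refl_mem_uniformity (hV n)))
    (fun r hr => by
      obtain ⟨n, -, hn⟩ := hbasis.mem_iff.1 hr
      refine hbasis.mem_iff.2 ⟨n + 1, trivial, ?_⟩
      rintro ⟨x, y⟩ h
      rw [hVs] at h
      refine hn (hVV n ?_)
      rw [hVs]
      exact hsymm _ (hV n) _ _ h)
    (fun r hr => by
      obtain ⟨n, -, hn⟩ := hbasis.mem_iff.1 hr
      refine ⟨V (n + 1), hbasis.mem_of_mem trivial, ?_⟩
      rintro ⟨x, z⟩ ⟨y, h₁, h₂⟩
      rw [hVs] at h₁ h₂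
      exact hn (hcomp _ (hV n) x y z z h₁ h₂ (refl_mem_uniformity (hW _ (hV n)))))
  refine ⟨UniformSpace.ofCore c, ?_, ?_, ?_⟩
  · exact le_iInf fun n => Filter.le_principal_iff.2 (hV n)
  · exact hbasis.mem_of_mem (i := 0) trivial
  · change (⨅ n, Filter.principal (V n)).IsCountablyGenerated
    infer_instance

/-- A uniform space has locally finite open covers by sets with arbitrarily small closures. -/
theorem exists_locallyFinite_cover_closure_prod_subset {X : Type u} [𝔘 : UniformSpace X]
    {E : Set (X × X)} (hE : E ∈ 𝓤 X) :
    ∃ L : X → Set X, (∀ z, IsOpen (L z)) ∧ LocallyFinite L ∧ (⋃ z, L z) = Set.univ ∧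
      ∀ z, closure (L z) ×ˢ closure (L z) ⊆ E := by
  -- The coarser uniformity is pseudometrizable, hence paracompact, and its open and closed sets
  -- stay so in the finer topology. The closed sets `K z` bound the closures in both.
  obtain ⟨𝔙, hle, hE𝔙, hcg⟩ := exists_isCountablyGenerated_uniformity_le hE
  have htop : 𝔘.toTopologicalSpace ≤ 𝔙.toTopologicalSpace :=
    UniformSpace.toTopologicalSpace_mono hle
  have key : ∃ L : X → Set X, ∃ K : X → Set X, (∀ z, IsOpen[𝔙.toTopologicalSpace] (L z)) ∧
      @LocallyFinite X X 𝔙.toTopologicalSpace L ∧ (⋃ z, L z) = Set.univ ∧ (∀ z, L z ⊆ K z) ∧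
      (∀ z, IsClosed[𝔙.toTopologicalSpace] (K z)) ∧ ∀ z, K z ×ˢ K z ⊆ E := by
    clear htop hle hE
    let _ := 𝔙
    let _ := UniformSpace.pseudoMetricSpace X
    obtain ⟨W, hW, hc, hsymm, hcomp⟩ := exists_isClosed_symm_comp_comp_subset hE𝔙
    obtain ⟨L, hLo, hLU, hLf, hL⟩ := precise_refinement
      (fun z => interior (UniformSpace.ball z W)) (fun z => isOpen_interior)
      (Set.eq_univ_of_forall fun z => Set.mem_iUnion.2
        ⟨z, mem_interior_iff_mem_nhds.2 (UniformSpace.ball_mem_nhds z hW)⟩)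
    refine ⟨L, fun z => UniformSpace.ball z W, hLo, hLf, hLU,
      fun z => (hL z).trans interior_subset, fun z => hc.preimage (by fun_prop), ?_⟩
    rintro z ⟨x, y⟩ ⟨hx, hy⟩
    exact hcomp x z y y (hsymm _ _ hx) hy (refl_mem_uniformity hW)
  obtain ⟨L, K, hLo, hLf, hLU, hLK, hKc, hKE⟩ := key
  have hsub (z : X) : @closure X 𝔘.toTopologicalSpace (L z) ⊆ K z :=
    @closure_minimal X 𝔘.toTopologicalSpace _ _ (hLK z) ((hKc z).mono htop)
  exact ⟨L, fun z => htop _ (hLo z), fun x => (hLf x).imp fun t ht => ⟨nhds_mono htop ht.1, ht.2⟩,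
    hLU, fun z => (Set.prod_mono (hsub z) (hsub z)).trans (hKE z)⟩

/-! ### Winning strategies separate points. -/

namespace ProximalStrategy

/-- Arbitrary answers of player 1 can be refined to a strategy whose entourages shrink fast. -/
theorem exists_refinement {X : Type u} [UniformSpace X]
    (E : (n : ℕ) → (Fin n → X) → Set (X × X)) (hE : ∀ n h, E n h ∈ 𝓤 X) :
    ∃ τ : ProximalStrategy X, (∀ n h, IsClosed (τ.move n h)) ∧
      (∀ n h a b c d, (a, b) ∈ τ.move n h → (b, c) ∈ τ.move n h → (c, d) ∈ τ.move n h →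
        (a, d) ∈ E n h) ∧
      ∀ n (h : Fin (n + 1) → X) a b c, (a, b) ∈ τ.move (n + 1) h → (b, c) ∈ τ.move (n + 1) h →
        (a, c) ∈ τ.move n fun i => h i.castSucc := by
  choose! W hW hc hsymm hcomp using
    fun (E : Set (X × X)) (hE : E ∈ 𝓤 X) => exists_isClosed_symm_comp_comp_subset hE
  let M : (n : ℕ) → (Fin n → X) → Set (X × X) := fun n => Nat.rec (fun h => W (E 0 h))
    (fun n ih h => W (E (n + 1) h ∩ ih fun i => h i.castSucc)) n
  have hM (n : ℕ) : ∀ h, M n h ∈ 𝓤 X := by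
    induction n with
    | zero => exact fun h => hW _ (hE _ h)
    | succ n ih => exact fun h => hW _ (Filter.inter_mem (hE _ h) (ih _))
  have hM' (n : ℕ) (h : Fin (n + 1) → X) : E (n + 1) h ∩ M n (fun i => h i.castSucc) ∈ 𝓤 X :=
    Filter.inter_mem (hE _ h) (hM _ _)
  have hdec (n : ℕ) (h : Fin (n + 1) → X) (a b c : X) (h₁ : (a, b) ∈ M (n + 1) h)
      (h₂ : (b, c) ∈ M (n + 1) h) : (a, c) ∈ M n fun i => h i.castSucc :=
    (hcomp _ (hM' n h) a b c c h₁ h₂ (refl_mem_uniformity (hM (n + 1) h))).2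
  refine ⟨⟨M, hM, fun n h x y => ?_, fun n h => ?_⟩, fun n h => ?_, fun n h a b c d => ?_, hdec⟩
  · cases n with
    | zero => exact hsymm _ (hE 0 h) x y
    | succ n => exact hsymm _ (hM' n h) x y
  · rintro ⟨x, y⟩ hxy
    exact hdec n h x y y hxy (refl_mem_uniformity (hM (n + 1) h))
  · cases n with
    | zero => exact hc _ (hE 0 h)
    | succ n => exact hc _ (hM' n h)
  · cases n with
    | zero => exact hcomp _ (hE 0 h) a b c d
    | succ n => exact fun h₁ h₂ h₃ => (hcomp _ (hM' n h) a b c d h₁ h₂ h₃).1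

theorem play_mem {X : Type u} [UniformSpace X] (σ : ProximalStrategy X) (x : ℕ → X) (n : ℕ) :
    σ.play x n ∈ 𝓤 X :=
  σ.entourage _ _

theorem play_symm {X : Type u} [UniformSpace X] (σ : ProximalStrategy X) {x : ℕ → X} {n : ℕ}
    {a b : X} (h : (a, b) ∈ σ.play x n) : (b, a) ∈ σ.play x n :=
  σ.symmetric _ _ _ _ h

theorem play_succ_subset {X : Type u} [UniformSpace X] (σ : ProximalStrategy X) (x : ℕ → X)
    (n : ℕ) : σ.play x (n + 1) ⊆ σ.play x n :=
  σ.decreasing n _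

end ProximalStrategy

namespace ProximalStrategy

/-- The entourages chosen against histories from a set `D` separate the points of its closure. -/
theorem IsWinning.eq_of_forall_mem {X : Type u} [UniformSpace X] [T2Space X]
    {σ τ : ProximalStrategy X} (hσ : σ.IsWinning)
    (hτ : ∀ n h a b c d, (a, b) ∈ τ.move n h → (b, c) ∈ τ.move n h → (c, d) ∈ τ.move n h →
      (a, d) ∈ σ.move n h)
    {D : Set X} {a b : X} (ha : a ∈ closure D) (hb : b ∈ closure D)
    (hab : ∀ (n : ℕ) (h : Fin n → X), (∀ i, h i ∈ D) → (a, b) ∈ τ.move n h) : a = b := by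
  by_contra hne
  obtain ⟨A, haA, hA, B, hbB, hB, hAB⟩ := exists_open_nhds_disjoint_closure hne
  let c : ℕ → X := fun n => if Even n then a else b
  let O : ℕ → Set X := fun n => if Even n then A else B
  have hc (n : ℕ) : c n ∈ closure D ∧ O n ∈ 𝓝 (c n) := by
    by_cases hn : Even n
    · simp [c, O, hn, ha, hA.mem_nhds haA]
    · simp [c, O, hn, hb, hB.mem_nhds hbB]
  have hpick (n : ℕ) (h : Fin n → D) :
      ∃ x : D, (x : X) ∈ O n ∧ (c n, (x : X)) ∈ τ.move n fun i => h i := by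
    obtain ⟨x, ⟨hx, hxτ⟩, hxD⟩ := mem_closure_iff_nhds.1 (hc n).1 _
      (Filter.inter_mem (hc n).2
        (UniformSpace.ball_mem_nhds (c n) (τ.entourage n fun i => h i)))
    exact ⟨⟨x, hxD⟩, hx, hxτ⟩
  choose F hFO hFτ using hpick
  obtain ⟨x, hx⟩ := exists_seq_eq_of_history F
  have hxO (n : ℕ) : (x n : X) ∈ O n := by rw [hx n]; exact hFO _ _
  have hxτ (n : ℕ) : (c n, (x n : X)) ∈ τ.move n fun i => (x i : X) := by
    have := hFτ n fun i => x i
    rwa [← hx n] at this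
  have hcc (n m k : ℕ) : (c m, c k) ∈ τ.move n fun i => (x i : X) := by
    have h := hab n (fun i => x i) fun i => (x i).2
    have hr (z : X) := refl_mem_uniformity (x := z) (τ.entourage n fun i => (x i : X))
    by_cases hm : Even m <;> by_cases hk : Even k <;> simp only [c, hm, hk, if_true, if_false]
    exacts [hr _, h, τ.symmetric _ _ _ _ h, hr _]
  have hxc (n m : ℕ) : ((x n : X), c m) ∈ σ.play (fun i => (x i : X)) n :=
    hτ _ _ _ _ _ _ (τ.symmetric _ _ _ _ (hxτ n)) (hcc n n m) (hcc n m m)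
  rcases hσ (fun n => x n) (fun n => hτ _ _ _ _ _ _ (τ.symmetric _ _ _ _ (hxτ n))
    (hcc n n (n + 1)) (τ.decreasing n _ (hxτ (n + 1)))) with h | ⟨z, hz⟩
  -- The point `c 0 = a` stays in every ball of the play.
  · exact (Set.eq_empty_iff_forall_notMem.1 h (c 0)) (Set.mem_iInter.2 fun n => hxc n 0)
  · have hA' : z ∈ closure A := by
      refine mem_closure_of_tendsto (hz.comp (Filter.tendsto_id.nsmul_atTop two_pos))
        (Filter.Eventually.of_forall fun n => ?_)
      have := hxO (2 * n)
      simpa [O] using this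
    have hB' : z ∈ closure B := by
      refine mem_closure_of_tendsto (hz.comp ((Filter.tendsto_add_atTop_nat 1).comp
        (Filter.tendsto_id.nsmul_atTop two_pos))) (Filter.Eventually.of_forall fun n => ?_)
      have := hxO (2 * n + 1)
      simpa [O] using this
    exact Set.disjoint_left.1 hAB hA' hB'

/-- If the entourages `V n` eventually refine every answer to a history from `D`, they generate
the uniformity of `D`. -/
theorem IsWinning.exists_inter_prod_subset {X : Type u} [UniformSpace X] [CompactSpace X]
    [T2Space X] {σ τ : ProximalStrategy X} (hσ : σ.IsWinning)
    (hτ : ∀ n h a b c d, (a, b) ∈ τ.move n h → (b, c) ∈ τ.move n h → (c, d) ∈ τ.move n h →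
      (a, d) ∈ σ.move n h)
    {D : Set X} {V : ℕ → Set (X × X)} (hV : Antitone V) (hVc : ∀ n, IsClosed (V n))
    (hVD : ∀ (n : ℕ) (h : Fin n → X), (∀ i, h i ∈ D) → ∃ k, V k ⊆ τ.move n h)
    {E : Set (X × X)} (hE : E ∈ 𝓤 X) : ∃ n, V n ∩ D ×ˢ D ⊆ E := by
  have hKc (n : ℕ) : IsClosed (V n ∩ closure D ×ˢ closure D) :=
    (hVc n).inter (isClosed_closure.prod isClosed_closure)
  obtain ⟨n, hn⟩ := exists_subset_nhds_of_isCompact' (U := E)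
    (V := fun n => V n ∩ closure D ×ˢ closure D)
    (Antitone.directed_ge fun m n h => Set.inter_subset_inter_left _ (hV h))
    (fun n => (hKc n).isCompact) hKc (by
      rintro ⟨a, b⟩ hab
      rw [Set.mem_iInter] at hab
      obtain rfl : a = b := hσ.eq_of_forall_mem hτ (hab 0).2.1 (hab 0).2.2 fun n h hh => by
        obtain ⟨k, hk⟩ := hVD n h hh
        exact hk (hab k).1
      exact nhds_le_uniformity a hE)
  exact ⟨n, (Set.inter_subset_inter_right _
    (Set.prod_mono subset_closure subset_closure)).trans hn⟩

end ProximalStrategy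

/-! ### Proximality of the uniform power. -/

theorem IsProximal.exists_isWinning {X : Type u} [𝔘 : UniformSpace X] [CompactSpace X]
    (hX : IsProximal X) : ∃ σ : ProximalStrategy X, σ.IsWinning := by
  obtain ⟨𝔘', h𝔘, σ, hσ⟩ := hX
  obtain rfl : 𝔘' = 𝔘 := @unique_uniformity_of_compact X 𝔘.toTopologicalSpace _ _ _ h𝔘 rfl
  exact ⟨σ, hσ⟩

theorem IsProximal.uniformPower {X : Type u} [UniformSpace X] [CompactSpace X] [T2Space X]
    (hX : IsProximal X) : IsProximal (UniformPower X) := by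
  obtain ⟨σ, hσ⟩ := hX.exists_isWinning
  obtain ⟨τ, hτc, hτ, -⟩ := ProximalStrategy.exists_refinement σ.move σ.entourage
  let V : (n : ℕ) → (Fin n → UniformPower X) → Set (X × X) := fun n f =>
    ⋂ (m : Fin (n + 1)) (g : Fin m → Fin n × Fin n),
      τ.move m fun i => UniformFun.toFun (f (g i).1) (g i).2
  have hV (n : ℕ) (f : Fin n → UniformPower X) : V n f ∈ 𝓤 X :=
    Filter.iInter_mem.2 fun m => Filter.iInter_mem.2 fun g => τ.entourage _ _
  have hVc (n : ℕ) (f : Fin n → UniformPower X) : IsClosed (V n f) :=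
    isClosed_iInter fun m => isClosed_iInter fun g => hτc _ _
  obtain ⟨ρ, -, hρ, hρρ⟩ := ProximalStrategy.exists_refinement
    (fun n f => UniformFun.gen ℕ X (V n f))
    (fun n f => (UniformFun.hasBasis_uniformity ℕ X).mem_of_mem (hV n f))
  refine ⟨inferInstance, rfl, ρ, fun f hf => Or.inr ?_⟩
  have hrefl (n : ℕ) (z : UniformPower X) : (z, z) ∈ ρ.play f n :=
    refl_mem_uniformity (ρ.play_mem f n)
  -- Composing two steps of inning `n + 1` costs one inning, so a whole chain of steps telescopes
  -- into the entourage of inning `n`.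
  have hstep (d : ℕ) : ∀ n, (f (n + 1), f (n + 1 + d)) ∈ ρ.play f n := by
    induction d with
    | zero => exact fun n => hrefl n _
    | succ d ih =>
      intro n
      have h := ih (n + 1)
      rw [show n + 1 + 1 + d = n + 1 + (d + 1) by omega] at h
      exact hρρ n _ _ _ _ (hf (n + 1)) h
  let D : Set X := {x | ∃ i k, x = UniformFun.toFun (f i) k}
  let U : ℕ → Set (X × X) := fun n => ⋂ j : Fin (n + 1), V j fun i => f i
  have hU : Antitone U := antitone_nat_of_succ_le fun n =>
    Set.subset_iInter fun j => Set.iInter_subset_of_subset j.castSucc le_rfl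
  have hUD (n : ℕ) (h : Fin n → X) (hh : ∀ i, h i ∈ D) : ∃ k, U k ⊆ τ.move n h := by
    choose p q hpq using hh
    -- Once `k` bounds the length of the history and exceeds all indices of its entries, inning `k`
    -- answers it.
    obtain ⟨k, hk⟩ : ∃ k, n ≤ k ∧ ∀ i, p i < k ∧ q i < k := by
      refine ⟨n + ∑ i, (p i + q i + 1), by omega, fun i => ?_⟩
      have := Finset.single_le_sum (f := fun i => p i + q i + 1) (fun _ _ => Nat.zero_le _)
        (Finset.mem_univ i)
      omega
    refine ⟨k, (Set.iInter_subset _ (Fin.last k)).trans ?_⟩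
    refine (Set.iInter₂_subset (⟨n, by simp; omega⟩ : Fin (k + 1))
      fun i => (⟨p i, (hk.2 i).1⟩, ⟨q i, (hk.2 i).2⟩)).trans ?_
    rw [show h = _ from funext hpq]
  have hcauchy : CauchySeq f := by
    refine (UniformFun.hasBasis_uniformity ℕ X).cauchySeq_iff'.2 fun E hE => ?_
    obtain ⟨n, hn⟩ := hσ.exists_inter_prod_subset hτ hU
      (fun n => isClosed_iInter fun j => hVc j fun i => f i) hUD (symm_le_uniformity hE)
    refine ⟨n + 1, fun m hm k => ?_⟩
    obtain ⟨d, rfl⟩ := Nat.exists_eq_add_of_le hm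
    have hmem (j : Fin (n + 1)) : (f (n + 1), f (n + 1 + d)) ∈ ρ.play f j := by
      have hanti : Antitone (ρ.play f) := antitone_nat_of_succ_le (ρ.play_succ_subset f)
      exact hanti (Nat.le_of_lt_succ j.2) (hstep d n)
    have hUk : (UniformFun.toFun (f (n + 1)) k, UniformFun.toFun (f (n + 1 + d)) k) ∈ U n :=
      Set.mem_iInter.2 fun j => hρ _ _ _ _ _ _ (hmem j) (hrefl _ _) (hrefl _ _) k
    exact hn ⟨hUk, ⟨n + 1, k, rfl⟩, ⟨n + 1 + d, k, rfl⟩⟩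
  exact cauchySeq_tendsto_of_complete hcauchy

/-! ### Corson compacta. -/

/-- Compact spaces that embed into a `Σ`-product are proximal. -/
theorem EmbedsInSigmaProduct.isProximal {X : Type u} [UniformSpace X] [CompactSpace X]
    [T2Space X] (hX : EmbedsInSigmaProduct X) : IsProximal X := by
  obtain ⟨κ, e, he, hsupp⟩ := hX
  have hec (α : κ) : Continuous fun x => e x α := (continuous_apply α).comp he.continuous
  choose f hf using fun x => Set.countable_iff_exists_injOn.1 (hsupp x)
  let A : (n : ℕ) → (Fin n → X) → Set κ := fun n h => ⋃ i, {α | e (h i) α ≠ 0 ∧ f (h i) α < n}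
  have hA (n : ℕ) (h : Fin n → X) : (A n h).Finite := by
    refine Set.finite_iUnion fun i => Set.Finite.of_finite_image (f := f (h i))
      ((Set.finite_lt_nat n).subset ?_) ((hf (h i)).mono fun α hα => hα.1)
    rintro _ ⟨α, hα, rfl⟩
    exact hα.2
  let M : (n : ℕ) → (Fin n → X) → Set (X × X) := fun n h =>
    ⋂ α ∈ A n h, {p | dist (e p.1 α) (e p.2 α) ≤ (1 / 2 : ℝ) ^ n}
  let σ : ProximalStrategy X :=
    { move := M
      entourage := fun n h => (Filter.biInter_mem (hA n h)).2 fun α _ =>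
        CompactSpace.uniformContinuous_of_continuous (hec α)
          (Metric.uniformity_basis_dist_le.mem_of_mem (i := (1 / 2 : ℝ) ^ n) (by positivity))
      symmetric := fun n h x y hxy => Set.mem_iInter₂.2 fun α hα => by
        have := Set.mem_iInter₂.1 hxy α hα
        simpa only [Set.mem_ofPred_eq, dist_comm] using this
      decreasing := fun n h p hp => Set.mem_iInter₂.2 fun α hα => by
        obtain ⟨i, hi⟩ := Set.mem_iUnion.1 hα
        have : dist (e p.1 α) (e p.2 α) ≤ (1 / 2 : ℝ) ^ (n + 1) := Set.mem_iInter₂.1 hp α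
          (Set.mem_iUnion.2 ⟨i.castSucc, hi.1, hi.2.trans n.lt_succ_self⟩)
        exact this.trans (pow_le_pow_of_le_one (by norm_num) (by norm_num) n.le_succ) }
  refine ⟨inferInstance, rfl, σ, fun x hx => Or.inr ?_⟩
  -- A coordinate that is nonzero at some played point is eventually controlled with geometric
  -- error; any other is constantly `0`.
  have hlim (α : κ) : ∃ z, Filter.Tendsto (fun n => e (x n) α) Filter.atTop (𝓝 z) := by
    by_cases hα : ∃ i, e (x i) α ≠ 0
    · obtain ⟨i, hi⟩ := hα
      obtain ⟨N, hN⟩ : ∃ N, i < N ∧ f (x i) α < N := ⟨i + f (x i) α + 1, by omega, by omega⟩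
      have hd (n : ℕ) : dist (e (x (n + N)) α) (e (x (n + 1 + N)) α) ≤ 1 * (1 / 2 : ℝ) ^ n := by
        have := Set.mem_iInter₂.1 (hx (n + N)) α
          (Set.mem_iUnion.2 ⟨⟨i, by omega⟩, hi, by show f (x i) α < n + N; omega⟩)
        rw [one_mul, show n + 1 + N = n + N + 1 by omega]
        exact le_trans this (pow_le_pow_of_le_one (by norm_num) (by norm_num) (by omega))
      obtain ⟨z, hz⟩ := cauchySeq_tendsto_of_complete
        (cauchySeq_of_le_geometric (1 / 2 : ℝ) 1 (by norm_num) hd)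
      exact ⟨z, (Filter.tendsto_add_atTop_iff_nat (f := fun n => e (x n) α) N).1 hz⟩
    · push Not at hα
      exact ⟨0, by simp only [hα]; exact tendsto_const_nhds⟩
  choose z hz using hlim
  have hz' : Filter.Tendsto (fun n => e (x n)) Filter.atTop (𝓝 z) := tendsto_pi_nhds.2 hz
  obtain ⟨a, rfl⟩ : z ∈ Set.range e :=
    (isCompact_range he.continuous).isClosed.mem_of_tendsto hz'
      (Filter.Eventually.of_forall fun n => ⟨x n, rfl⟩)
  exact ⟨a, he.tendsto_nhds_iff.2 hz'⟩

/-! ### Topological properties of proximal spaces. -/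

/-- A proximal Hausdorff space is a Fréchet–Urysohn space. -/
theorem IsProximal.frechetUrysohnSpace {Y : Type u} [t : TopologicalSpace Y] [T2Space Y]
    (hY : IsProximal Y) : FrechetUrysohnSpace Y := by
  obtain ⟨𝔘, rfl, σ, hσ⟩ := hY
  refine ⟨fun A y hy => ?_⟩
  -- Player 2 alternates between `y` and points of `A` near `y`. As `y` lies in every ball, the play
  -- converges, and its constant subsequence forces the limit `y`.
  have hpick (n : ℕ) (h : Fin n → Y) :
      ∃ x, (y, x) ∈ σ.move n h ∧ (Even n → x = y) ∧ (¬Even n → x ∈ A) := by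
    by_cases hn : Even n
    · exact ⟨y, refl_mem_uniformity (σ.entourage n h), fun _ => rfl, fun h' => absurd hn h'⟩
    · obtain ⟨x, hx, hxA⟩ := mem_closure_iff_nhds.1 hy _
        (UniformSpace.ball_mem_nhds y (σ.entourage n h))
      exact ⟨x, hx, fun h' => absurd h' hn, fun _ => hxA⟩
  choose F hFσ hFe hFo using hpick
  obtain ⟨x, hx⟩ := exists_seq_eq_of_history F
  have hxσ (n : ℕ) : (x n, y) ∈ σ.play x n := by
    refine σ.play_symm ?_
    have := hFσ n fun i => x i
    rwa [← hx n] at this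
  have hxe (n : ℕ) (hn : Even n) : x n = y := by rw [hx n]; exact hFe _ _ hn
  have hxo (n : ℕ) (hn : ¬Even n) : x n ∈ A := by rw [hx n]; exact hFo _ _ hn
  have hrefl (n : ℕ) : (y, y) ∈ σ.play x n := refl_mem_uniformity (σ.play_mem x n)
  have hleg (n : ℕ) : x (n + 1) ∈ UniformSpace.ball (x n) (σ.play x n) := by
    change (x n, x (n + 1)) ∈ σ.play x n
    by_cases hn : Even n
    · rw [hxe n hn]
      exact σ.play_succ_subset x n (σ.play_symm (hxσ (n + 1)))
    · rw [hxe (n + 1) (Nat.even_add_one.2 hn)]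
      exact hxσ n
  rcases hσ x hleg with h | ⟨z, hz⟩
  · exact absurd (Set.mem_iInter.2 hxσ) (Set.eq_empty_iff_forall_notMem.1 h y)
  · have htwo : Filter.Tendsto (fun n => 2 * n) Filter.atTop Filter.atTop :=
      Filter.tendsto_id.nsmul_atTop two_pos
    obtain rfl : z = y := by
      refine tendsto_nhds_unique (hz.comp htwo) ?_
      rw [show x ∘ (fun n => 2 * n) = fun _ => y from funext fun n => hxe _ (even_two_mul n)]
      exact tendsto_const_nhds
    exact ⟨fun n => x (2 * n + 1), fun n => hxo _ (by simp),
      hz.comp ((Filter.tendsto_add_atTop_nat 1).comp htwo)⟩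

/-- Adds a point of `S` that is related to the history `h` by `Q`, or `z` if there is none. -/
noncomputable def snocWitness {Y : Type u} (Q : (n : ℕ) → (Fin n → Y) → Y → Prop) {n : ℕ}
    (h : Fin n → Y) (S : Set Y) (z : Y) : Fin (n + 1) → Y :=
  open scoped Classical in
  Fin.snoc (α := fun _ => Y) h (if H : ∃ x ∈ S, Q n h x then H.choose else z)

/-- A node of the tree of refinements: an open set and a history of the game against `σ`. -/
noncomputable def refinementNode {Y : Type u} [UniformSpace Y] (σ : ProximalStrategy Y)
    (Q : (n : ℕ) → (Fin n → Y) → Y → Prop) (L : Set (Y × Y) → Y → Set Y) :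
    (n : ℕ) → (Fin n → Y) → Set Y × (Fin n → Y)
  | 0, s => (Set.univ, s)
  | n + 1, s =>
    let p := refinementNode σ Q L n (Fin.init s)
    let O := p.1 ∩ L (σ.move n p.2) (s (Fin.last n))
    (O, snocWitness Q p.2 (closure O) (s (Fin.last n)))

/-- Near a point only finitely many parents occur, and each has a locally finite family of children.
-/
theorem locallyFinite_refinementNode {Y : Type u} [UniformSpace Y] (σ : ProximalStrategy Y)
    (Q : (n : ℕ) → (Fin n → Y) → Y → Prop) {L : Set (Y × Y) → Y → Set Y}
    (hL : ∀ E ∈ 𝓤 Y, LocallyFinite (L E)) (n : ℕ) :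
    LocallyFinite fun s : Fin n → Y => (refinementNode σ Q L n s).1 := by
  induction n with
  | zero => exact locallyFinite_of_finite _
  | succ n ih =>
    intro y
    obtain ⟨W, hW, hfin⟩ := ih y
    choose! t ht htfin using fun s : Fin n → Y =>
      hL _ (σ.entourage n (refinementNode σ Q L n s).2) y
    refine ⟨W ∩ ⋂ s ∈ {s | ((refinementNode σ Q L n s).1 ∩ W).Nonempty}, t s,
      Filter.inter_mem hW ((Filter.biInter_mem hfin).2 fun s _ => ht s), ?_⟩
    refine (hfin.biUnion fun s _ => (htfin s).image
      fun z => (Fin.snoc (α := fun _ => Y) s z : Fin (n + 1) → Y)).subset ?_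
    rintro s ⟨y', ⟨hy₁, hy₂⟩, hyW, hyt⟩
    have hmem : Fin.init s ∈ {s | ((refinementNode σ Q L n s).1 ∩ W).Nonempty} :=
      ⟨y', hy₁, hyW⟩
    refine Set.mem_biUnion hmem ⟨s (Fin.last n), ⟨y', hy₂, ?_⟩, Fin.snoc_init_self s⟩
    exact Set.mem_iInter₂.1 hyt _ hmem

/-- Suppose that a set which is not small has, for each finite history, a point that is related
to it by `Q`, and that no convergent sequence consists of such points. If player 1 has a winning
strategy, then there is a `σ`-locally finite open cover by sets whose closures are small. -/
theorem ProximalStrategy.IsWinning.exists_sigma_locallyFinite_cover {Y : Type u}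
    [UniformSpace Y] {σ : ProximalStrategy Y} (hσ : σ.IsWinning) {small : Set Y → Prop}
    {Q : (n : ℕ) → (Fin n → Y) → Y → Prop}
    (hQ : ∀ S, ¬small S → ∀ n h, ∃ x ∈ S, Q n h x)
    (hconv : ∀ (x : ℕ → Y) (a : Y), Filter.Tendsto x Filter.atTop (𝓝 a) →
      ∃ n, ¬Q n (fun i => x i) (x n)) :
    ∃ (ι : ℕ → Type u) (T : (n : ℕ) → ι n → Set Y), (∀ n i, IsOpen (T n i)) ∧
      (∀ n, LocallyFinite (T n)) ∧ (∀ y, ∃ n i, y ∈ T n i) ∧ ∀ n i, small (closure (T n i)) := by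
  choose! L hLo hLf hLU hLE using fun (E : Set (Y × Y)) (hE : E ∈ 𝓤 Y) =>
    exists_locallyFinite_cover_closure_prod_subset hE
  let N := refinementNode σ Q L
  refine ⟨fun n => {s : Fin n → Y // small (closure (N n s).1)}, fun n s => (N n s.1).1,
    fun n s => ?_, fun n => (locallyFinite_refinementNode σ Q hLf n).comp_injective
      Subtype.val_injective, fun y => ?_, fun n s => s.2⟩
  · obtain ⟨s, hs⟩ := s
    change IsOpen (N n s).1
    clear hs
    induction n with
    | zero => exact isOpen_univ
    | succ n ih => exact (ih (Fin.init s)).inter (hLo _ (σ.entourage _ _) _)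
  -- An uncovered `y` lies on a branch of nodes that are never small. The witnesses along it form a
  -- legal play with `y` in every ball.
  by_contra! hy
  have hpick (n : ℕ) (s : Fin n → Y) : ∃ z, y ∈ L (σ.move n (N n s).2) z :=
    Set.mem_iUnion.1 ((hLU _ (σ.entourage n (N n s).2)).symm ▸ Set.mem_univ y)
  choose F hF using hpick
  obtain ⟨k, hk⟩ := exists_seq_eq_of_history F
  have hyN (n : ℕ) : y ∈ (N n fun i => k i).1 := by
    induction n with
    | zero => exact Set.mem_univ y
    | succ n ih =>
      refine ⟨ih, ?_⟩
      have := hF n fun i => k i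
      rwa [← hk n] at this
  have hbad (n : ℕ) : ¬small (closure (N n fun i => k i).1) := fun h =>
    hy n ⟨_, h⟩ (hyN n)
  let x : ℕ → Y := fun n => (N (n + 1) fun i => k i).2 (Fin.last n)
  have hN (n : ℕ) : (N (n + 1) fun i => k i).2 =
      snocWitness Q (N n fun i => k i).2 (closure (N (n + 1) fun i => k i).1) (k n) := rfl
  have hx (n : ℕ) : (N n fun i => k i).2 = fun i : Fin n => x i := by
    induction n with
    | zero => exact Subsingleton.elim _ _
    | succ n ih =>
      funext i
      refine Fin.lastCases rfl (fun i => ?_) i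
      rw [hN, snocWitness, Fin.snoc_castSucc, ih]
      rfl
  have hxQ (n : ℕ) : x n ∈ closure (N (n + 1) fun i => k i).1 ∧ Q n (fun i => x i) (x n) := by
    have H := hQ _ (hbad (n + 1)) n (N n fun i => k i).2
    have : x n = H.choose := by
      change (N (n + 1) fun i => k i).2 (Fin.last n) = _
      rw [hN, snocWitness, Fin.snoc_last]
      exact dif_pos H
    rw [← hx n, this]
    exact H.choose_spec
  have hsub (n : ℕ) : (N (n + 1) fun i => k i).1 ⊆ (N n fun i => k i).1 := Set.inter_subset_left
  have hsmall (n : ℕ) (a b : Y) (ha : a ∈ closure (N (n + 1) fun i => k i).1)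
      (hb : b ∈ closure (N (n + 1) fun i => k i).1) : (a, b) ∈ σ.play x n := by
    have h : (N (n + 1) fun i => k i).1 ⊆ L (σ.play x n) (k n) := by
      rw [ProximalStrategy.play, ← hx n]
      exact Set.inter_subset_right
    exact hLE _ (σ.play_mem x n) (k n) ⟨closure_mono h ha, closure_mono h hb⟩
  rcases hσ x fun n => hsmall n _ _ (hxQ n).1 (closure_mono (hsub (n + 1)) (hxQ (n + 1)).1)
    with h | ⟨a, ha⟩
  · exact Set.eq_empty_iff_forall_notMem.1 h y (Set.mem_iInter.2 fun n =>
      hsmall n _ _ (hxQ n).1 (subset_closure (hyN (n + 1))))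
  · obtain ⟨n, hn⟩ := hconv x a ha
    exact hn (hxQ n).2

/-- A proximal Hausdorff space is collectionwise normal. -/
theorem IsProximal.isCollectionwiseNormal {Y : Type u} [t : TopologicalSpace Y] [T2Space Y]
    (hY : IsProximal Y) : IsCollectionwiseNormal Y := by
  obtain ⟨𝔘, rfl, σ, hσ⟩ := hY
  refine ⟨inferInstance, fun κ F hF hdisc => ?_⟩
  have huniq {x : Y} {i j : κ} (hi : x ∈ F i) (hj : x ∈ F j) : i = j := by
    obtain ⟨W, hW, hWs⟩ := hdisc x
    exact hWs ⟨x, hi, mem_of_mem_nhds hW⟩ ⟨x, hj, mem_of_mem_nhds hW⟩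
  obtain ⟨ι, T, hTo, hTf, hTc, hT⟩ := hσ.exists_sigma_locallyFinite_cover
    (small := fun S => {i | (F i ∩ S).Nonempty}.Subsingleton)
    -- Only the immediately preceding point, of index `n - 1`, matters: consecutive points lie in
    -- different members, whereas a convergent sequence would end up in a single one.
    (Q := fun n h x => ∃ i, x ∈ F i ∧ ∀ j : Fin n, (j : ℕ) + 1 = n → h j ∉ F i)
    (by
      intro S hS n h
      obtain ⟨i, ⟨a, hai, haS⟩, j, ⟨b, hbj, hbS⟩, hij⟩ := Set.not_subsingleton_iff.1 hS
      by_cases hi : ∀ k : Fin n, (k : ℕ) + 1 = n → h k ∉ F i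
      · exact ⟨a, haS, i, hai, hi⟩
      · push Not at hi
        obtain ⟨k, hk, hki⟩ := hi
        refine ⟨b, hbS, j, hbj, fun l hl hlj => hij (huniq hki ?_)⟩
        rwa [show k = l from Fin.ext (by omega)])
    (by
      intro x a ha
      by_contra! hx
      obtain ⟨W, hW, hWs⟩ := hdisc a
      obtain ⟨N, hN⟩ := Filter.eventually_atTop.1 (ha hW)
      obtain ⟨i, hi, -⟩ := hx N
      obtain ⟨j, hj, hij⟩ := hx (N + 1)
      obtain rfl : i = j := hWs ⟨_, hi, hN N le_rfl⟩ ⟨_, hj, hN (N + 1) (by omega)⟩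
      exact hij (Fin.last N) rfl hi)
  -- From level `n` around `F i`, remove the closures at levels up to `n` that meet other members.
  -- No point of `F i` is lost, since each closure meets at most one member.
  let G : ℕ → κ → Set Y := fun n i => ⋃ s ∈ {s : ι n | (F i ∩ closure (T n s)).Nonempty}, T n s
  let H : ℕ → κ → Set Y := fun n i =>
    ⋃ s : {s : ι n // ∃ j, j ≠ i ∧ (F j ∩ closure (T n s)).Nonempty}, closure (T n s)
  have hH (n : ℕ) (i : κ) : IsClosed (H n i) :=
    ((hTf n).closure.comp_injective Subtype.val_injective).isClosed_iUnion
      fun _ => isClosed_closure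
  have hGH {n : ℕ} {i j : κ} (hij : j ≠ i) : G n j ⊆ H n i :=
    Set.iUnion₂_subset fun s hs =>
      subset_closure.trans (Set.subset_iUnion_of_subset ⟨s, j, hij, hs⟩ subset_rfl)
  refine ⟨fun i => ⋃ n, G n i \ ⋃ m ∈ Set.Iic n, H m i, fun i => ?_, fun i x hx => ?_,
    fun i j hij => Set.disjoint_left.2 fun x hxi hxj => ?_⟩
  · refine isOpen_iUnion fun n => IsOpen.sdiff (isOpen_biUnion fun s _ => hTo n s) ?_
    exact (Set.finite_Iic n).isClosed_biUnion fun m _ => hH m i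
  · obtain ⟨n, s, hs⟩ := hTc x
    refine Set.mem_iUnion.2 ⟨n, Set.mem_biUnion (show _ from ⟨x, hx, subset_closure hs⟩) hs,
      fun hxH => ?_⟩
    obtain ⟨m, -, hm⟩ := Set.mem_iUnion₂.1 hxH
    obtain ⟨⟨s', j, hji, hj⟩, hs'⟩ := Set.mem_iUnion.1 hm
    exact hji (hT m s' hj ⟨x, hx, hs'⟩)
  · obtain ⟨n, hn, hn'⟩ := Set.mem_iUnion.1 hxi
    obtain ⟨m, hm, hm'⟩ := Set.mem_iUnion.1 hxj
    rcases le_total n m with h | h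
    · exact hm' (Set.mem_biUnion (Set.mem_Iic.2 h) (hGH hij hn))
    · exact hn' (Set.mem_biUnion (Set.mem_Iic.2 h) (hGH hij.symm hm))

/-- A proximal Hausdorff space is countably paracompact. -/
theorem IsProximal.isCountablyParacompact {Y : Type u} [t : TopologicalSpace Y] [T2Space Y]
    (hY : IsProximal Y) : IsCountablyParacompact Y := by
  obtain ⟨𝔘, rfl, σ, hσ⟩ := hY
  refine ⟨inferInstance, fun U hUo hU => ?_⟩
  let C : ℕ → Set Y := fun n => ⋃ m ∈ Set.Iic n, U m
  have hC : Monotone C := fun m n h => Set.biUnion_subset_biUnion_left (Set.Iic_subset_Iic.2 h)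
  have hUC (n : ℕ) : U n ⊆ C n := Set.subset_biUnion_of_mem (u := U) (Set.mem_Iic.2 le_rfl)
  have hcov (y : Y) : ∃ n, y ∈ U n := Set.mem_iUnion.1 (hU ▸ Set.mem_univ y)
  obtain ⟨ι, T, hTo, hTf, hTc, hT⟩ := hσ.exists_sigma_locallyFinite_cover
    (small := fun S => ∃ N, S ⊆ C N) (Q := fun n _ x => x ∉ C n)
    (by
      intro S hS n _
      push Not at hS
      exact Set.not_subset.1 (hS n))
    (by
      intro x a ha
      by_contra! hx
      obtain ⟨k, hk⟩ := hcov a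
      obtain ⟨N, hN⟩ := Filter.eventually_atTop.1 (ha ((hUo k).mem_nhds hk))
      exact hx (max N k) (hC (le_max_right N k) (hUC k (hN _ (le_max_left N k)))))
  choose N hN using hT
  -- Only levels and bounds up to `k` enter, so closures commute with these unions and the closure
  -- of `E k` stays in `C k`. Hence a point survives in the first `U n` containing it.
  let E : ℕ → Set Y := fun k => ⋃ n ∈ Set.Iic k, ⋃ s : {s : ι n // N n s ≤ k}, T n s
  have hE (k : ℕ) : closure (E k) ⊆ C k := by
    rw [(Set.finite_Iic k).closure_biUnion]
    refine Set.iUnion₂_subset fun n _ => ?_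
    refine ((hTf n).comp_injective
      Subtype.val_injective).closure_iUnion.subset.trans ?_
    exact Set.iUnion_subset fun s => (hN n s).trans (hC s.2)
  have hEo (k : ℕ) : IsOpen (E k) :=
    isOpen_biUnion fun n _ => isOpen_iUnion fun s => hTo n s
  refine ⟨fun n => U n \ ⋃ k ∈ Set.Iio n, closure (E k), fun n => ?_, ?_, fun y => ?_,
    fun n => Set.sdiff_subset⟩
  · exact (hUo n).sdiff ((Set.finite_Iio n).isClosed_biUnion fun k _ => isClosed_closure)
  · refine Set.eq_univ_of_forall fun y => ?_
    classical
    refine Set.mem_iUnion.2 ⟨Nat.find (hcov y), Nat.find_spec (hcov y), fun h => ?_⟩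
    obtain ⟨k, hk, hyk⟩ := Set.mem_iUnion₂.1 h
    obtain ⟨m, hm, hym⟩ := Set.mem_iUnion₂.1 (hE k hyk)
    exact Nat.find_min (hcov y) (lt_of_le_of_lt hm hk) hym
  · obtain ⟨n, s, hs⟩ := hTc y
    have hy : y ∈ E (max n (N n s)) :=
      Set.mem_biUnion (Set.mem_Iic.2 (le_max_left _ _))
        (Set.mem_iUnion.2 ⟨⟨s, le_max_right _ _⟩, hs⟩)
    refine ⟨_, (hEo _).mem_nhds hy, (Set.finite_Iic (max n (N n s))).subset ?_⟩
    rintro m ⟨x, ⟨-, hx⟩, hxE⟩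
    by_contra hm
    exact hx (Set.mem_biUnion (Set.mem_Iio.2 (not_le.1 hm)) (subset_closure hxE))

theorem mainTheorem1 (X : Type u) [UniformSpace X] [CompactSpace X] [T2Space X] :
    (IsProximal X → IsProximal (UniformPower X)) ∧
    (EmbedsInSigmaProduct X →
      IsCollectionwiseNormal (UniformPower X) ∧ IsCountablyParacompact (UniformPower X) ∧
        FrechetUrysohnSpace (UniformPower X)) := by
  refine ⟨IsProximal.uniformPower, fun hX => ?_⟩
  have h := hX.isProximal.uniformPower
  exact ⟨h.isCollectionwiseNormal, h.isCountablyParacompact, h.frechetUrysohnSpace⟩
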